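/- An ideal on $\mathbb{N}=\{0,1,2,\dots\}$ is a family of subsets of $\mathbb{N}$ closed under subsets and finite unions and containing all finite sets; $\langle\mathcal A\rangle$ denotes the smallest ideal containing $\mathcal A$. An ideal is tall if every infinite subset of $\mathbb{N}$ has an infinite subset in the ideal. For $\mathscr c:[\mathbb{N}]^d\to\{0,1\}$ and $i\in\{0,1\}$, $\hom_i(\mathscr c)$ is the family of all $A\subseteq\mathbb{N}$ (finite or infinite) such that every $d$-element subset of $A$ has color $i$, and $\hom(\mathscr c)=\hom_0(\mathscr c)\cup\hom_1(\mathscr c)$. For a sequence $\mathbf x=(x_n)_n$ in a real Banach space $X$, $$\mathcal B(\mathbf x)=\Big\{M\subseteq\mathbb{N}:\ \sup_{F\subseteq M\text{ finite}}\Big\|\sum_{n\in F}x_n\Big\|<\infty\Big\},$$ and an ideal is $\mathcal B$-representable in $X$ if it equals $\mathcal B(\mathbf x)$ for some sequence $\mathbf x$ in $X$. Families of subsets of $\mathbb{N}$ are regarded as subsets of $\{0,1\}^{\mathbb{N}}\subseteq[0,1]^{\mathbb{N}}$ via characteristic functions. For a compact $K\subseteq[0,1]^{\mathbb{N}}$,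 $\mathbf p^K=(p^K_n)_n$ is the sequence in $C(K)$ (real continuous functions with the supremum norm) given by $p^K_n(x)=x(n)$. The families $\hom_i(\mathscr c)$ and the Schreier family $\mathcal S=\{s\subseteq\mathbb{N}\text{ finite}: s=\emptyset\text{ or }\#s\le\min s+1\}$ are compact. **Theorem.** Let $\theta:\mathbb{N}\to\mathbb{Q}\cap(0,1)$ be a bijection and let $\mathfrak{conv}:[\mathbb{N}]^3\to\{0,1\}$ be the coloring for which, when $k<l<m$, $\mathfrak{conv}(\{k,l,m\})=1$ if and only if $|\theta(l)-\theta(m)|<\frac1{k+1}$. Then: 1. for every $\mathscr c:[\mathbb{N}]^2\to\{0,1\}$, $\hom(\mathscr c)\not\subseteq\langle\hom(\mathfrak{conv})\rangle$ (in particular $\hom(\mathscr c)\not\subseteq\hom(\mathfrak{conv})$) and $\hom(\mathscr c)\not\subseteq\mathcal B(\mathbf p^{\hom_0(\mathfrak{conv})})$; 2. $\mathcal B(\mathbf p^{\hom_0(\mathfrak{conv})})$ is a tall ideal that is $\mathcal B$-representable in $C(\mathcal S)$ but not $\mathcal B$-representable in $c_0$. -/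

import Mathlib

open Set TopologicalSpace

noncomputable section

namespace ConvColoring

/-- Ideals on `ℕ`: closed under subsets and finite unions, and containing all finite sets. -/
structure IsIdealOn (I : Set (Set ℕ)) : Prop where
  finite_mem : ∀ A : Set ℕ, A.Finite → A ∈ I
  subset_mem : ∀ A B : Set ℕ, A ⊆ B → B ∈ I → A ∈ I
  union_mem : ∀ A B : Set ℕ, A ∈ I → B ∈ I → A ∪ B ∈ I

/-- The ideal generated by a family of subsets of `ℕ`. -/
def generatedIdeal (𝓐 : Set (Set ℕ)) : Set (Set ℕ) :=
  {A | ∀ I : Set (Set ℕ), IsIdealOn I → 𝓐 ⊆ I → A ∈ I}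

/-- Tallness: every infinite set has an infinite subset in the family. -/
def IsTall (I : Set (Set ℕ)) : Prop :=
  ∀ A : Set ℕ, A.Infinite → ∃ B : Set ℕ, B ⊆ A ∧ B.Infinite ∧ B ∈ I

/-- The family `𝓑(x)` of all `M ⊆ ℕ` such that the norms of the sums of `x` over the finite
subsets of `M` are bounded. -/
def BIdeal {X : Type*} [NormedAddCommGroup X] (x : ℕ → X) : Set (Set ℕ) :=
  {M | BddAbove {r : ℝ | ∃ F : Finset ℕ, (F : Set ℕ) ⊆ M ∧ r = ‖∑ n ∈ F, x n‖}}

/-- `𝓑`-representability in a (real) Banach space `X`. -/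
def BRepresentable (X : Type*) [NormedAddCommGroup X] [NormedSpace ℝ X] [CompleteSpace X]
    (I : Set (Set ℕ)) : Prop :=
  ∃ x : ℕ → X, I = BIdeal x

/-- `2`-colorings of the `d`-element subsets of `ℕ`. -/
abbrev Coloring (d : ℕ) : Type := Set.powersetCard ℕ d → Fin 2

/-- The homogeneous sets of color `i`, including the sets with fewer than `d` elements. -/
def homColor {d : ℕ} (c : Coloring d) (i : Fin 2) : Set (Set ℕ) :=
  {A | ∀ s : Set.powersetCard ℕ d, ((s : Finset ℕ) : Set ℕ) ⊆ A → c s = i}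

/-- The homogeneous sets of a coloring. -/
def hom {d : ℕ} (c : Coloring d) : Set (Set ℕ) := ⋃ i : Fin 2, homColor c i

open Classical in
/-- The coloring of triples in which `{k < l < m}` has color `1` iff
`|θ l - θ m| < 1 / (k + 1)`. -/
def conv (θ : ℕ ≃ Set.Ioo (0 : ℚ) 1) : Coloring 3 := fun s =>
  if ∃ k l m : ℕ, k < l ∧ l < m ∧ (s : Finset ℕ) = {k, l, m} ∧
      |((θ l : ℚ) - (θ m : ℚ))| < 1 / ((k : ℚ) + 1)
  then 1 else 0

/-- The evaluation sequence of a compact `K ⊆ [0,1]^ℕ`, in the Banach space `C(K)`. -/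
def evalSeq (K : Compacts (ℕ → unitInterval)) (n : ℕ) : C(K, ℝ) where
  toFun x := ((x : ℕ → unitInterval) n : ℝ)
  continuous_toFun :=
    continuous_subtype_val.comp ((continuous_apply n).comp continuous_subtype_val)

open Classical in
/-- The characteristic function of a subset of `ℕ`, as a point of `[0,1]^ℕ`. -/
def charPt (A : Set ℕ) : ℕ → unitInterval := fun n => if n ∈ A then 1 else 0

theorem isClosed_charPt_image (P : Finset ℕ → Prop) :
    IsClosed (charPt '' {A : Set ℕ | ∀ t : Finset ℕ, (t : Set ℕ) ⊆ A → P t}) := by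
  have key : charPt '' {A : Set ℕ | ∀ t : Finset ℕ, (t : Set ℕ) ⊆ A → P t} =
      (⋂ n : ℕ, {x : ℕ → unitInterval | x n = 0 ∨ x n = 1}) ∩
      (⋂ t : Finset ℕ, ⋂ _ : ¬ P t, ⋃ n ∈ t, {x : ℕ → unitInterval | x n = 0}) := by
    ext x
    simp only [mem_image, mem_ofPred_eq, mem_inter_iff, mem_iInter, mem_iUnion, exists_prop]
    constructor
    · rintro ⟨A, hA, rfl⟩
      refine ⟨fun n => ?_, fun t ht => ?_⟩
      · by_cases h : n ∈ A <;> simp [charPt, h]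
      · by_contra! hcon
        apply ht
        apply hA
        intro n hn
        by_contra hnA
        exact hcon n (by simpa using hn) (by simp [charPt, hnA])
    · rintro ⟨h1, h2⟩
      refine ⟨{n | x n = 1}, fun t ht => ?_, ?_⟩
      · by_contra hP
        obtain ⟨n, hn, hn0⟩ := h2 t hP
        have h3 : x n = 1 := ht (by simpa using hn)
        rw [hn0] at h3
        exact zero_ne_one h3
      · funext n
        rcases h1 n with h | h <;> simp [charPt, h]
  rw [key]
  refine IsClosed.inter (isClosed_iInter fun n => ?_)
    (isClosed_iInter fun t => isClosed_iInter fun _ => ?_)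
  · exact (isClosed_eq (continuous_apply n) continuous_const).union
      (isClosed_eq (continuous_apply n) continuous_const)
  · exact t.finite_toSet.isClosed_biUnion fun n _ =>
      isClosed_eq (continuous_apply n) continuous_const

theorem isClosed_charPt_homColor {d : ℕ} (c : Coloring d) (i : Fin 2) :
    IsClosed (charPt '' homColor c i) := by
  have h := isClosed_charPt_image
    (fun t => ∀ ht : t ∈ Set.powersetCard ℕ d, c ⟨t, ht⟩ = i)
  convert h using 2
  ext A
  constructor
  · intro hA t htA ht
    exact hA ⟨t, ht⟩ htA
  · intro hA s hs
    exact hA s hs s.2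

/-- The family `hom_i(c)` as a compact subset of `[0,1]^ℕ`. -/
def homCompacts {d : ℕ} (c : Coloring d) (i : Fin 2) : Compacts (ℕ → unitInterval) :=
  ⟨charPt '' homColor c i, (isClosed_charPt_homColor c i).isCompact⟩

/-- The Schreier family: all finite sets `s` with `#s ≤ min s + 1` (and the empty set). -/
def schreier : Set (Set ℕ) :=
  {A | ∃ s : Finset ℕ, (s : Set ℕ) = A ∧ ∀ n ∈ s, s.card ≤ n + 1}

theorem isClosed_charPt_schreier : IsClosed (charPt '' schreier) := by
  have h := isClosed_charPt_image (fun t => ∀ n ∈ t, t.card ≤ n + 1)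
  convert h using 2
  ext A
  constructor
  · rintro ⟨s, rfl, hs⟩ t hts n hn
    have hts' : t ⊆ s := by exact_mod_cast hts
    exact (Finset.card_le_card hts').trans (hs n (hts' hn))
  · intro hA
    have hfin : A.Finite := by
      by_contra hinf
      obtain ⟨a, ha⟩ := (show A.Infinite from hinf).nonempty
      obtain ⟨t, htA, htc⟩ := (show A.Infinite from hinf).exists_subset_card_eq (a + 2)
      have h1 : ((insert a t : Finset ℕ) : Set ℕ) ⊆ A := by
        rw [Finset.coe_insert]
        exact Set.insert_subset ha htA
      have h2 := hA _ h1 a (Finset.mem_insert_self a t)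
      have h3 := Finset.card_le_card (Finset.subset_insert a t)
      omega
    exact ⟨hfin.toFinset, hfin.coe_toFinset, hA hfin.toFinset (by simp)⟩

/-- The Schreier family as a compact subset of `[0,1]^ℕ`. -/
def schreierCompacts : Compacts (ℕ → unitInterval) :=
  ⟨charPt '' schreier, isClosed_charPt_schreier.isCompact⟩

end ConvColoring

end

noncomputable section

namespace ConvColoring

open Set TopologicalSpace Filter Topology

/-! Evaluating sums of the `p_n` at characteristic functions shows that `M` lies in the ideal iff
the finite `conv`-0-homogeneous subsets of `M` have bounded size. 1-homogeneous sets contain no such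
triple, and 0-homogeneous sets are finite by pigeonhole, so the ideal contains `⟨hom(conv)⟩`.
Tallness comes from convergent subsequences of `θ`.

The core is `exists_homogeneous_separated`: a coloring `r` of pairs has a homogeneous `M` with
0-homogeneous subsets of every size. Attach to each real `y` in `(0,1)` a free ultrafilter along
which `θ` tends to `y`. Taking limit colors twice gives `f y a` and a coloring `d` of pairs of
reals. As the reals are uncountable, some `x` is approximated by arbitrarily long `d`-homogeneous
sequences of one color. Integers chosen generically for their ultrafilters are far apart under `θ`
and extend a finite homogeneous set while preserving compatibility with `x`.

For `C(𝒮)`: a 0-homogeneous set without its minimum is Schreier, so initial segments of Schreier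
sets detect homogeneity. For `c₀`: a gliding hump turns a tall represented ideal into a coloring of
pairs with all its homogeneous sets inside, which the core forbids. -/

/-! ### Ramsey's theorem and an uncountable pigeonhole principle -/

/-- Along an ultrafilter, a function with two values is eventually constant. -/
theorem exists_eventually_eq {α : Type*} (U : Ultrafilter α) (g : α → Fin 2) :
    ∃ i, ∀ᶠ b in (U : Filter α), g b = i := by
  rcases U.em (fun b => g b = 0) with h | h
  · exact ⟨0, h⟩
  · exact ⟨1, h.mono fun b hb => by grind⟩

/-- Ramsey's theorem for pairs, for sequences in an infinite type. -/
theorem exists_seq_homogeneous {α : Type*} [Infinite α] (d : α → α → Fin 2) :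
    ∃ (ε : Fin 2) (s : ℕ → α), ∀ i j, i < j → s i ≠ s j ∧ d (s i) (s j) = ε := by
  classical
  choose e he using fun x => exists_eventually_eq (hyperfilter α) (d x)
  obtain ⟨ε, hε⟩ := exists_eventually_eq (hyperfilter α) e
  obtain ⟨s, -, hs⟩ := exists_seq_of_forall_finset_exists (fun x => e x = ε)
    (fun x y => x ≠ y ∧ d x y = ε) (by
      intro s hs
      have h : ∀ x ∈ s, ∀ᶠ y in (hyperfilter α : Filter α), x ≠ y ∧ d x y = ε := fun x hx => by
        have h1 : ∀ᶠ y in (hyperfilter α : Filter α), y ≠ x :=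
          hyperfilter_le_cofinite (Set.finite_singleton x).compl_mem_cofinite
        filter_upwards [h1, he x] with y hy hy'
        exact ⟨hy.symm, hy'.trans (hs x hx)⟩
      exact (hε.and ((Filter.eventually_all_finset s).2 h)).exists)
  exact ⟨ε, s, fun i j hij => hs i j hij⟩

/-- Given colors of pairs and points of an uncountable type with a `0`-`1` sequence attached to
each, some point is accumulated by long homogeneous sequences in its own color. -/
theorem exists_accumulation_homogeneous {Y : Type*} [Uncountable Y] (f : Y → ℕ → Fin 2)
    (d : Y → Y → Fin 2) :
    ∃ (x : Y) (ε : Fin 2), ∀ (N : ℕ) (F : Finset ℕ), ∃ y : ℕ → Y,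
      (∀ i j, i < j → y i ≠ y j) ∧ (∀ i j, i < j → j < N → d (y i) (y j) = ε) ∧
      (∀ i < N, d (y i) x = ε) ∧ ∀ i, ∀ a ∈ F, f (y i) a = f x a := by
  classical
  by_contra! hcon
  choose N F hNF using hcon
  -- If every `x` fails for both colors, countably many codes record bounds valid for both failures,
  -- together with `f x` on the relevant finite set; so some fiber is infinite.
  let code : Y → ℕ × Finset ℕ × Finset ℕ := fun x =>
    (N x 0 + N x 1, F x 0 ∪ F x 1, (F x 0 ∪ F x 1).filter fun a => f x a = 0)
  obtain ⟨p, hp⟩ : ∃ p, (code ⁻¹' {p}).Infinite := by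
    by_contra! h
    have h1 : (Set.univ : Set Y) = ⋃ p, code ⁻¹' {p} := by ext; simp
    exact Set.not_countable_univ (h1 ▸ Set.countable_iUnion fun p => (h p).countable)
  have := hp.to_subtype
  obtain ⟨ε, s, hs⟩ := exists_seq_homogeneous (fun x y : code ⁻¹' {p} => d x y)
  have hsp : ∀ i, code (s i) = p := fun i => (s i).2
  have hε : ε = 0 ∨ ε = 1 := by grind
  have hN : N (s p.1) ε ≤ p.1 := by
    have h := congrArg Prod.fst (hsp p.1)
    simp only [code] at h
    rcases hε with rfl | rfl <;> omega
  have hF : F (s p.1) ε ⊆ p.2.1 := by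
    have h := congrArg (fun q => q.2.1) (hsp p.1)
    simp only [code] at h
    rw [← h]
    rcases hε with rfl | rfl
    · exact Finset.subset_union_left
    · exact Finset.subset_union_right
  have hf : ∀ i, ∀ a ∈ p.2.1, f (s i) a = 0 ↔ a ∈ p.2.2 := by
    intro i a ha
    have h1 := congrArg (fun q => q.2.1) (hsp i)
    have h2 := congrArg (fun q => q.2.2) (hsp i)
    simp only [code] at h1 h2
    rw [← h2, Finset.mem_filter, h1]
    simp only [ha, true_and]
  -- The term of index `p.1` serves as `x`: at least `N x ε` terms precede it, all in color `ε` with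
  -- it, and the common code makes them agree on `F x ε`.
  obtain ⟨i, a, ha, hne⟩ := hNF (s p.1) ε (fun i => s i)
    (fun i j hij h => (hs i j hij).1 (Subtype.ext h)) (fun i j hij _ => (hs i j hij).2)
    (fun i hi => (hs i _ (hi.trans_le hN)).2)
  have h1 := hf i a (hF ha)
  have h2 := hf p.1 a (hF ha)
  grind

/-! ### Limit colors along ultrafilters and separated homogeneous sets -/

/-- Every point of the unit interval is a limit of the enumerated rationals along a free
ultrafilter. -/
theorem exists_ultrafilter_tendsto (θ : ℕ ≃ Set.Ioo (0 : ℚ) 1) (y : Set.Ioo (0 : ℝ) 1) :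
    ∃ U : Ultrafilter ℕ, (U : Filter ℕ) ≤ atTop ∧
      Tendsto (fun n => ((θ n : ℚ) : ℝ)) U (𝓝 (y : ℝ)) := by
  have hcl : MapClusterPt (y : ℝ) atTop (fun n => ((θ n : ℚ) : ℝ)) := by
    rw [mapClusterPt_iff_frequently]
    intro s hs
    obtain ⟨δ, hδ, hball⟩ := Metric.mem_nhds_iff.1 hs
    -- The maximum with `0` keeps the rational interval `(a, b)` inside the range of `θ`.
    obtain ⟨a, ha1, ha2⟩ := exists_rat_btwn (max_lt y.2.1 (sub_lt_self (y : ℝ) hδ))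
    obtain ⟨b, hb1, hb2⟩ := exists_rat_btwn ha2
    have hinf : (θ ⁻¹' {q | a < (q : ℚ) ∧ (q : ℚ) < b}).Infinite := by
      apply Set.Infinite.preimage
      · have h := (Set.Ioo_infinite (show a < b by exact_mod_cast hb1)).preimage
          (f := (Subtype.val : Set.Ioo (0 : ℚ) 1 → ℚ)) (by
            rw [Subtype.range_val]
            have h0 : (0 : ℝ) < a := (le_max_left _ _).trans_lt ha1
            have h1 : (b : ℝ) < 1 := hb2.trans y.2.2
            exact Set.Ioo_subset_Ioo (by exact_mod_cast h0.le) (by exact_mod_cast h1.le))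
        exact h
      · simp
    refine (Nat.frequently_atTop_iff_infinite.2 hinf).mono fun n hn => hball ?_
    have h1 : (a : ℝ) < (θ n : ℚ) := by exact_mod_cast hn.1
    have h2 : ((θ n : ℚ) : ℝ) < b := by exact_mod_cast hn.2
    have h3 := (le_max_right _ _).trans_lt ha1
    rw [Metric.mem_ball, Real.dist_eq, abs_lt]
    constructor <;> linarith
  obtain ⟨U, hU, hy⟩ := mapClusterPt_iff_ultrafilter.1 hcl
  exact ⟨U, hU, hy⟩

/-- Finitely many free ultrafilters with separated limits, compatible with the color `ε`, allow to
append a large separated set to a homogeneous set. -/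
theorem exists_separated_extension {t : ℕ → ℝ} {r : ℕ → ℕ → Fin 2} {ε : Fin 2} {N : ℕ}
    {U : ℕ → Ultrafilter ℕ} (hU : ∀ i, (U i : Filter ℕ) ≤ atTop) {y : ℕ → ℝ}
    (hy : ∀ i, Tendsto t (U i) (𝓝 (y i))) {δ : ℝ} (hδ : 0 < δ)
    (hsep : ∀ i j, i < j → j < N → 3 * δ ≤ |y i - y j|)
    {f : ℕ → ℕ → Fin 2} (hf : ∀ i a, ∀ᶠ b in (U i : Filter ℕ), r a b = f i a)
    {g : ℕ → Fin 2}
    (hff : ∀ i j, i < j → j < N → ∀ᶠ b in (U i : Filter ℕ), f j b = ε)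
    (hfg : ∀ i < N, ∀ᶠ b in (U i : Filter ℕ), g b = ε)
    {M : Finset ℕ} (hM : ∀ a ∈ M, ∀ b ∈ M, a < b → r a b = ε) (hMg : ∀ a ∈ M, g a = ε)
    (hMf : ∀ i < N, ∀ a ∈ M, f i a = ε) (K : ℕ) (n : ℕ) (hn : n ≤ N) :
    ∃ A : Finset ℕ, A.card = n ∧ (∀ a ∈ A, K ≤ a) ∧
      (∀ a ∈ M ∪ A, ∀ b ∈ M ∪ A, a < b → r a b = ε) ∧ (∀ a ∈ M ∪ A, g a = ε) ∧
      (∀ a ∈ M ∪ A, ∀ j, n ≤ j → j < N → f j a = ε) ∧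
      (∀ a ∈ A, ∃ i < n, |t a - y i| < δ) ∧ ∀ a ∈ A, ∀ b ∈ A, a < b → δ ≤ |t a - t b| := by
  classical
  induction n with
  | zero =>
    refine ⟨∅, by simp, by simp, by simpa using hM, by simpa using hMg, ?_, by simp, by simp⟩
    intro a ha j _ hj
    exact hMf j hj a (by simpa using ha)
  | succ n ih =>
    obtain ⟨A, hA, hK, hr, hg, hfA, ht, hs⟩ := ih (by omega)
    -- A `U n`-generic `b` works: `f n = ε` on the earlier elements gives the right pair colors, and
    -- `hff`, `hfg` keep `b` compatible with the later ultrafilters and with `g`.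
    have e1 : ∀ᶠ b in (U n : Filter ℕ), ∀ a ∈ M ∪ A, a < b :=
      (Filter.eventually_all_finset _).2 fun a _ => hU n (eventually_gt_atTop a)
    have e2 : ∀ᶠ b in (U n : Filter ℕ), ∀ a ∈ M ∪ A, r a b = ε :=
      (Filter.eventually_all_finset _).2 fun a ha =>
        (hf n a).mono fun b hb => hb.trans (hfA a ha n le_rfl (by omega))
    have e3 : ∀ᶠ b in (U n : Filter ℕ), ∀ j ∈ Finset.range N, n < j → f j b = ε :=
      (Filter.eventually_all_finset _).2 fun j hj => by
        by_cases hnj : n < j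
        · exact (hff n j hnj (Finset.mem_range.1 hj)).mono fun b hb _ => hb
        · simp [hnj]
    have e4 : ∀ᶠ b in (U n : Filter ℕ), |t b - y n| < δ := by
      simpa [Real.dist_eq] using Metric.tendsto_nhds.1 (hy n) δ hδ
    obtain ⟨b, h1, h2, h3, h4, h5, h6⟩ := (e1.and (e2.and (e3.and (e4.and
      ((hfg n (by omega)).and (hU n (eventually_ge_atTop K))))))).exists
    have hbA : b ∉ A := fun h => (h1 b (Finset.mem_union_right _ h)).false
    have hmem : ∀ a, a ∈ M ∪ insert b A ↔ a = b ∨ a ∈ M ∪ A := by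
      intro a
      simp only [Finset.mem_union, Finset.mem_insert]
      tauto
    refine ⟨insert b A, by simp [hbA, hA], ?_, ?_, ?_, ?_, ?_, ?_⟩
    · intro a ha
      rcases Finset.mem_insert.1 ha with rfl | ha
      exacts [h6, hK a ha]
    · intro a ha c hc hac
      rcases (hmem a).1 ha with rfl | ha' <;> rcases (hmem c).1 hc with rfl | hc'
      · exact absurd hac (lt_irrefl _)
      · exact absurd (h1 c hc') hac.not_gt
      · exact h2 a ha'
      · exact hr a ha' c hc' hac
    · intro a ha
      rcases (hmem a).1 ha with rfl | ha
      exacts [h5, hg a ha]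
    · intro a ha j hnj hj
      rcases (hmem a).1 ha with rfl | ha
      exacts [h3 j (Finset.mem_range.2 hj) (by omega), hfA a ha j (by omega) hj]
    · intro a ha
      rcases Finset.mem_insert.1 ha with rfl | ha
      · exact ⟨n, by omega, h4⟩
      · obtain ⟨i, hi, h⟩ := ht a ha
        exact ⟨i, by omega, h⟩
    -- The limits are `3 * δ` apart and each value is within `δ` of its limit, leaving a gap of `δ`.
    · have key : ∀ a ∈ A, δ ≤ |t a - t b| := by
        intro a ha
        obtain ⟨i, hi, h⟩ := ht a ha
        have h7 := hsep i n hi (by omega)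
        have h8 : |y i - y n| ≤ |t a - y i| + |t a - t b| + |t b - y n| := by
          have := abs_add_three (-(t a - y i)) (t a - t b) (t b - y n)
          rw [abs_neg] at this
          refine le_trans (le_of_eq ?_) this
          congr 1
          ring
        linarith
      intro a ha c hc hac
      rcases Finset.mem_insert.1 ha with rfl | ha' <;>
        rcases Finset.mem_insert.1 hc with rfl | hc'
      · exact absurd hac (lt_irrefl _)
      · exact absurd (h1 c (Finset.mem_union_right _ hc')) hac.not_gt
      · exact key a ha'
      · exact hs a ha' c hc' hac

/-- Every `2`-coloring of pairs has a homogeneous set that contains arbitrarily large finite sets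
which are separated in terms of their least element. -/
theorem exists_homogeneous_separated (θ : ℕ ≃ Set.Ioo (0 : ℚ) 1) (r : ℕ → ℕ → Fin 2) :
    ∃ (ε : Fin 2) (M : Set ℕ), (∀ a ∈ M, ∀ b ∈ M, a < b → r a b = ε) ∧
      ∀ N : ℕ, ∃ A : Finset ℕ, (A : Set ℕ) ⊆ M ∧ A.card = N ∧ ∀ k ∈ A, ∀ l ∈ A, ∀ m ∈ A,
        l < m → 1 / ((k : ℝ) + 1) ≤ |((θ l : ℚ) : ℝ) - ((θ m : ℚ) : ℝ)| := by
  classical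
  choose U hU hUy using exists_ultrafilter_tendsto θ
  -- `f y a` is the limit of `r a b` as `b` follows `U y`; `d x y` is the limit of `f y` along `U
  -- x`.
  choose f hf using fun y a => exists_eventually_eq (U y) (r a)
  choose d hd using fun x y => exists_eventually_eq (U x) (f y)
  have hunc : Uncountable (Set.Ioo (0 : ℝ) 1) := by
    rw [← not_countable_iff]
    exact fun h => (Cardinal.Real.Ioo_countable_iff.1 (Set.countable_coe_iff.1 h)).not_gt one_pos
  obtain ⟨x, ε, hx⟩ := exists_accumulation_homogeneous f d
  let Good : Finset ℕ → Prop := fun M =>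
    (∀ a ∈ M, ∀ b ∈ M, a < b → r a b = ε) ∧ ∀ a ∈ M, f x a = ε
  have step : ∀ (M : {M // Good M}) (N : ℕ), ∃ M' : {M // Good M}, M.1 ⊆ M'.1 ∧
      ∃ A : Finset ℕ, A ⊆ M'.1 ∧ A.card = N ∧ ∀ k ∈ A, ∀ l ∈ A, ∀ m ∈ A,
        l < m → 1 / ((k : ℝ) + 1) ≤ |((θ l : ℚ) : ℝ) - ((θ m : ℚ) : ℝ)| := by
    rintro ⟨M, hM, hMx⟩ N
    obtain ⟨y, hinj, hyy, hyx, hyM⟩ := hx N M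
    obtain ⟨δ, hδ, hsep⟩ : ∃ δ > (0 : ℝ), ∀ i j, i < j → j < N →
        3 * δ ≤ |(y i : ℝ) - (y j : ℝ)| := by
      have h : ∀ p ∈ ((Finset.range N ×ˢ Finset.range N).filter fun p => p.1 < p.2),
          ∀ᶠ δ in 𝓝[>] (0 : ℝ), 3 * δ ≤ |(y p.1 : ℝ) - (y p.2 : ℝ)| := by
        intro p hp
        have hpos : 0 < |(y p.1 : ℝ) - (y p.2 : ℝ)| :=
          abs_pos.2 (sub_ne_zero.2 fun h => hinj _ _ (Finset.mem_filter.1 hp).2 (Subtype.ext h))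
        have : Tendsto (fun δ : ℝ => 3 * δ) (𝓝[>] 0) (𝓝 0) := by
          have h : Tendsto (fun δ : ℝ => 3 * δ) (𝓝 0) (𝓝 (3 * 0)) :=
            tendsto_id.const_mul 3
          rw [mul_zero] at h
          exact h.mono_left nhdsWithin_le_nhds
        exact (this.eventually (gt_mem_nhds hpos)).mono fun _ h => le_of_lt h
      obtain ⟨δ, h1, h2⟩ := (((Filter.eventually_all_finset _).2 h).and
        (eventually_mem_nhdsWithin (a := (0 : ℝ)) (s := Set.Ioi 0))).exists
      refine ⟨δ, h2, fun i j hij hj => h1 (i, j) ?_⟩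
      simp only [Finset.mem_filter, Finset.mem_product, Finset.mem_range]
      omega
    -- Elements `k ≥ K` satisfy `1 / (k + 1) < δ`, so separation by `δ` suffices.
    obtain ⟨K, hK⟩ := exists_nat_one_div_lt hδ
    obtain ⟨A, hA, hAK, hAr, hAx, -, -, hAs⟩ := exists_separated_extension (t := fun n => (θ n : ℚ))
      (r := r) (ε := ε) (N := N) (U := fun i => U (y i)) (fun i => hU _) (y := fun i => y i)
      (fun i => hUy _) hδ hsep (f := fun i => f (y i)) (fun i a => hf _ a) (g := f x)
      (fun i j hij hj => (hd (y i) (y j)).mono fun b hb => hb.trans (hyy i j hij hj))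
      (fun i hi => (hd (y i) x).mono fun b hb => hb.trans (hyx i hi)) hM hMx
      (fun i _ a ha => (hyM i a ha).trans (hMx a ha)) K N le_rfl
    refine ⟨⟨M ∪ A, hAr, hAx⟩, Finset.subset_union_left, A, Finset.subset_union_right, hA, ?_⟩
    intro k hk l hl m hm hlm
    refine le_trans ?_ (hAs l hl m hm hlm)
    refine le_trans (one_div_le_one_div_of_le (by positivity) ?_) hK.le
    have := hAK k hk
    gcongr
  choose nxt hsub hA using step
  let S : ℕ → {M // Good M} := fun n =>
    Nat.rec ⟨∅, by simp [Good]⟩ (fun n M => nxt M n) n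
  have hmono : Monotone fun n => (S n).1 := monotone_nat_of_le_succ fun n => hsub (S n) n
  refine ⟨ε, ⋃ n, ((S n).1 : Set ℕ), ?_, ?_⟩
  · intro a ha b hb hab
    obtain ⟨i, hi⟩ := Set.mem_iUnion.1 ha
    obtain ⟨j, hj⟩ := Set.mem_iUnion.1 hb
    exact (S (max i j)).2.1 a (hmono (le_max_left i j) hi) b (hmono (le_max_right i j) hj) hab
  · intro N
    obtain ⟨A, h1, h2, h3⟩ := hA (S N) N
    refine ⟨A, fun a ha => Set.mem_iUnion.2 ⟨N + 1, h1 ha⟩, h2, h3⟩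

/-! ### The ideals `𝓑(x)` and their combinatorial form for evaluation sequences -/

theorem isIdealOn_BIdeal {X : Type*} [NormedAddCommGroup X] (x : ℕ → X) :
    IsIdealOn (BIdeal x) where
  finite_mem A hA := by
    have hfin : {F : Finset ℕ | (F : Set ℕ) ⊆ A}.Finite := by
      refine hA.toFinset.powerset.finite_toSet.subset fun F hF => ?_
      simpa [Set.Finite.subset_toFinset] using hF
    refine ((hfin.image fun F => ‖∑ n ∈ F, x n‖).subset ?_).bddAbove
    rintro r ⟨F, hF, rfl⟩
    exact ⟨F, hF, rfl⟩
  subset_mem A B hAB hB := BddAbove.mono (by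
    rintro r ⟨F, hF, rfl⟩
    exact ⟨F, hF.trans hAB, rfl⟩) hB
  union_mem A B hA hB := by
    classical
    obtain ⟨a, ha⟩ := hA
    obtain ⟨b, hb⟩ := hB
    refine ⟨a + b, ?_⟩
    rintro r ⟨F, hF, rfl⟩
    rw [← Finset.sum_filter_add_sum_filter_not F (fun n => n ∈ A)]
    refine (norm_add_le _ _).trans (add_le_add (ha ⟨_, ?_, rfl⟩) (hb ⟨_, ?_, rfl⟩))
    · intro n hn
      exact (Finset.mem_filter.1 hn).2
    · intro n hn
      have h := Finset.mem_filter.1 hn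
      exact (hF h.1).resolve_left h.2

theorem homColor_mono {d : ℕ} (c : Coloring d) (i : Fin 2) {A B : Set ℕ} (hAB : A ⊆ B)
    (hB : B ∈ homColor c i) : A ∈ homColor c i :=
  fun s hs => hB s (hs.trans hAB)

/-- At the characteristic function of `A`, the sum over `F` counts `F ∩ A`, which is again
homogeneous; the norm is thus the largest size of a homogeneous subset of `F`. -/
theorem mem_BIdeal_evalSeq_homCompacts {d : ℕ} (c : Coloring d) (i : Fin 2) (M : Set ℕ) :
    M ∈ BIdeal (evalSeq (homCompacts c i)) ↔
      ∃ C : ℕ, ∀ A : Finset ℕ, (A : Set ℕ) ⊆ M → (A : Set ℕ) ∈ homColor c i → A.card ≤ C := by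
  classical
  have hval : ∀ (F : Finset ℕ) (A : Set ℕ) (hA : A ∈ homColor c i),
      (∑ n ∈ F, evalSeq (homCompacts c i) n) ⟨charPt A, A, hA, rfl⟩ =
        ((F.filter (· ∈ A)).card : ℝ) := by
    intro F A hA
    rw [ContinuousMap.sum_apply, Finset.card_filter, Nat.cast_sum]
    refine Finset.sum_congr rfl fun n _ => ?_
    by_cases hn : n ∈ A <;> simp [evalSeq, charPt, hn]
  constructor
  · rintro ⟨C, hC⟩
    refine ⟨⌊C⌋₊, fun A hAM hA => Nat.le_floor ?_⟩
    refine le_trans ?_ (hC ⟨A, hAM, rfl⟩)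
    have h := (∑ n ∈ A, evalSeq (homCompacts c i) n).norm_coe_le_norm
      ⟨charPt A, A, hA, rfl⟩
    rw [hval A A hA] at h
    simpa using h
  · rintro ⟨C, hC⟩
    refine ⟨C, ?_⟩
    rintro r ⟨F, hF, rfl⟩
    refine (ContinuousMap.norm_le _ (Nat.cast_nonneg C)).2 ?_
    rintro ⟨_, A, hA, rfl⟩
    rw [hval F A hA, Real.norm_of_nonneg (Nat.cast_nonneg _), Nat.cast_le]
    refine hC _ (fun n hn => hF (Finset.mem_filter.1 hn).1) (homColor_mono c i ?_ hA)
    exact fun n hn => (Finset.mem_filter.1 hn).2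

/-! ### The coloring `conv` and the size of its 0-homogeneous sets -/

theorem eq_of_triple_eq {k l m k' l' m' : ℕ} (hkl : k < l) (hlm : l < m) (hkl' : k' < l')
    (hlm' : l' < m') (h : ({k, l, m} : Finset ℕ) = {k', l', m'}) : k = k' ∧ l = l' ∧ m = m' := by
  have h1 : ∀ n, (n = k ∨ n = l ∨ n = m) ↔ (n = k' ∨ n = l' ∨ n = m') := by
    intro n
    simpa using Finset.ext_iff.1 h n
  have := (h1 k).1 (by simp)
  have := (h1 l).1 (by simp)
  have := (h1 m).1 (by simp)
  have := (h1 k').2 (by simp)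
  have := (h1 l').2 (by simp)
  have := (h1 m').2 (by simp)
  omega

theorem conv_eq_one_iff (θ : ℕ ≃ Set.Ioo (0 : ℚ) 1) (s : Set.powersetCard ℕ 3) {k l m : ℕ}
    (hkl : k < l) (hlm : l < m) (hs : (s : Finset ℕ) = {k, l, m}) :
    conv θ s = 1 ↔ |((θ l : ℚ) - (θ m : ℚ))| < 1 / ((k : ℚ) + 1) := by
  unfold conv
  constructor
  · intro h
    split_ifs at h with h'
    · obtain ⟨k', l', m', h1, h2, h3, h4⟩ := h'
      obtain ⟨rfl, rfl, rfl⟩ := eq_of_triple_eq hkl hlm h1 h2 (hs.symm.trans h3)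
      exact h4
    · exact absurd h (by decide)
  · intro h
    rw [if_pos ⟨k, l, m, hkl, hlm, hs, h⟩]

theorem exists_triple_eq (s : Set.powersetCard ℕ 3) :
    ∃ k l m : ℕ, k < l ∧ l < m ∧ (s : Finset ℕ) = {k, l, m} := by
  obtain ⟨f, hf⟩ : ∃ f : Fin 3 ↪o ℕ, Set.range f = ((s : Finset ℕ) : Set ℕ) :=
    ⟨(s : Finset ℕ).orderEmbOfFin (Set.powersetCard.mem_iff.1 s.2), by simp⟩
  refine ⟨f 0, f 1, f 2, by simp, by simp, ?_⟩
  apply Finset.coe_injective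
  rw [← hf]
  ext n
  simp [Fin.exists_fin_succ, eq_comm]

theorem mem_homColor_conv_one (θ : ℕ ≃ Set.Ioo (0 : ℚ) 1) (A : Set ℕ) :
    A ∈ homColor (conv θ) 1 ↔ ∀ k ∈ A, ∀ l ∈ A, ∀ m ∈ A, k < l → l < m →
      |((θ l : ℚ) - (θ m : ℚ))| < 1 / ((k : ℚ) + 1) := by
  constructor
  · intro h k hk l hl m hm hkl hlm
    have hs : ({k, l, m} : Finset ℕ) ∈ Set.powersetCard ℕ 3 :=
      Set.powersetCard.mem_iff.2 (Finset.card_eq_three.2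
        ⟨k, l, m, hkl.ne, (hkl.trans hlm).ne, hlm.ne, rfl⟩)
    refine (conv_eq_one_iff θ ⟨_, hs⟩ hkl hlm rfl).1 (h ⟨_, hs⟩ ?_)
    intro n hn
    simp only [Finset.coe_insert, Finset.coe_singleton, Set.mem_insert_iff,
      Set.mem_singleton_iff] at hn
    rcases hn with rfl | rfl | rfl <;> assumption
  · intro h s hs
    obtain ⟨k, l, m, hkl, hlm, he⟩ := exists_triple_eq s
    rw [he] at hs
    exact (conv_eq_one_iff θ s hkl hlm he).2
      (h k (hs (by simp)) l (hs (by simp)) m (hs (by simp)) hkl hlm)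

theorem mem_homColor_conv_zero (θ : ℕ ≃ Set.Ioo (0 : ℚ) 1) (A : Set ℕ) :
    A ∈ homColor (conv θ) 0 ↔ ∀ k ∈ A, ∀ l ∈ A, ∀ m ∈ A, k < l → l < m →
      1 / ((k : ℚ) + 1) ≤ |((θ l : ℚ) - (θ m : ℚ))| := by
  constructor
  · intro h k hk l hl m hm hkl hlm
    have hs : ({k, l, m} : Finset ℕ) ∈ Set.powersetCard ℕ 3 :=
      Set.powersetCard.mem_iff.2 (Finset.card_eq_three.2
        ⟨k, l, m, hkl.ne, (hkl.trans hlm).ne, hlm.ne, rfl⟩)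
    by_contra! hcon
    have h1 := (conv_eq_one_iff θ ⟨_, hs⟩ hkl hlm rfl).2 hcon
    rw [h ⟨_, hs⟩] at h1
    · exact absurd h1 (by decide)
    intro n hn
    simp only [Finset.coe_insert, Finset.coe_singleton, Set.mem_insert_iff,
      Set.mem_singleton_iff] at hn
    rcases hn with rfl | rfl | rfl <;> assumption
  · intro h s hs
    obtain ⟨k, l, m, hkl, hlm, he⟩ := exists_triple_eq s
    rw [he] at hs
    have h1 := h k (hs (by simp)) l (hs (by simp)) m (hs (by simp)) hkl hlm
    have h2 : conv θ s ≠ 1 := fun h2 => ((conv_eq_one_iff θ s hkl hlm he).1 h2).not_ge h1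
    grind

/-- In a `0`-homogeneous finite set, at most `k + 1` elements lie above the element `k`. -/
theorem card_filter_lt_le (θ : ℕ ≃ Set.Ioo (0 : ℚ) 1) {A : Finset ℕ}
    (hA : (A : Set ℕ) ∈ homColor (conv θ) 0) {k : ℕ} (hk : k ∈ A) :
    (A.filter (k < ·)).card ≤ k + 1 := by
  rw [mem_homColor_conv_zero] at hA
  have hpos : (0 : ℚ) < (k : ℚ) + 1 := by positivity
  have hθ : ∀ n, 0 ≤ (θ n : ℚ) * ((k : ℚ) + 1) := fun n => mul_nonneg (θ n).2.1.le hpos.le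
  rw [← Finset.card_range (k + 1)]
  -- Cut `(0,1)` into `k + 1` cells of length `1 / (k + 1)`: elements above `k` are too far apart to
  -- share one.
  refine Finset.card_le_card_of_injOn (fun n => ⌊(θ n : ℚ) * ((k : ℚ) + 1)⌋₊) ?_ ?_
  · intro n _
    simp only [Finset.coe_range, Set.mem_Iio]
    rw [Nat.floor_lt (hθ n)]
    push_cast
    exact mul_lt_of_lt_one_left hpos (θ n).2.2
  · have key : ∀ l ∈ A, ∀ m ∈ A, k < l → l < m →
        ⌊(θ l : ℚ) * ((k : ℚ) + 1)⌋₊ ≠ ⌊(θ m : ℚ) * ((k : ℚ) + 1)⌋₊ := by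
      intro l hl m hm hkl hlm he
      have h1 := hA k hk l hl m hm hkl hlm
      have h2 := Nat.floor_le (hθ l)
      have h3 := Nat.lt_floor_add_one ((θ l : ℚ) * ((k : ℚ) + 1))
      have h4 := Nat.floor_le (hθ m)
      have h5 := Nat.lt_floor_add_one ((θ m : ℚ) * ((k : ℚ) + 1))
      rw [he] at h2 h3
      rw [div_le_iff₀ hpos, ← abs_of_pos hpos, ← abs_mul, sub_mul] at h1
      refine h1.not_gt (abs_lt.2 ⟨?_, ?_⟩) <;> linarith
    intro l hl m hm he
    have hl' := Finset.mem_filter.1 hl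
    have hm' := Finset.mem_filter.1 hm
    rcases lt_trichotomy l m with h | h | h
    · exact absurd he (key l hl'.1 m hm'.1 hl'.2 h)
    · exact h
    · exact absurd he.symm (key m hm'.1 l hl'.1 hm'.2 h)

theorem card_le_of_mem_homColor_conv_zero (θ : ℕ ≃ Set.Ioo (0 : ℚ) 1) {A : Finset ℕ}
    (hA : (A : Set ℕ) ∈ homColor (conv θ) 0) {k : ℕ} (hk : k ∈ A) (hmin : ∀ n ∈ A, k ≤ n) :
    A.card ≤ k + 2 := by
  have h : A = insert k (A.filter (k < ·)) := by
    ext n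
    simp only [Finset.mem_insert, Finset.mem_filter]
    have := hmin n
    grind
  rw [h]
  exact (Finset.card_insert_le _ _).trans (by have := card_filter_lt_le θ hA hk; omega)

/-! ### Homogeneous sets in the ideal, and tallness -/

theorem homColor_conv_one_subset_BIdeal (θ : ℕ ≃ Set.Ioo (0 : ℚ) 1) :
    homColor (conv θ) 1 ⊆ BIdeal (evalSeq (homCompacts (conv θ) 0)) := by
  intro M hM
  rw [mem_BIdeal_evalSeq_homCompacts]
  refine ⟨2, fun A hAM hA => ?_⟩
  by_contra! hcard
  obtain ⟨s, hs, hs'⟩ := Finset.exists_subset_card_eq (show 3 ≤ A.card from hcard)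
  have h0 := hA ⟨s, Set.powersetCard.mem_iff.2 hs'⟩ (Finset.coe_subset.2 hs)
  have h1 := hM ⟨s, Set.powersetCard.mem_iff.2 hs'⟩ ((Finset.coe_subset.2 hs).trans hAM)
  exact absurd (h0.symm.trans h1) (by decide)

theorem homColor_conv_zero_subset_BIdeal (θ : ℕ ≃ Set.Ioo (0 : ℚ) 1) :
    homColor (conv θ) 0 ⊆ BIdeal (evalSeq (homCompacts (conv θ) 0)) := by
  intro M hM
  refine (isIdealOn_BIdeal _).finite_mem M ?_
  by_contra hinf
  obtain ⟨k, hk⟩ := (show M.Infinite from hinf).nonempty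
  obtain ⟨A, hAM, hA⟩ := ((show M.Infinite from hinf).sdiff (Set.finite_Iic k)).exists_subset_card_eq
    (k + 2)
  have hsub : ((insert k A : Finset ℕ) : Set ℕ) ⊆ M := by
    rw [Finset.coe_insert]
    exact Set.insert_subset hk (hAM.trans Set.sdiff_subset)
  have h := card_filter_lt_le θ (homColor_mono _ _ hsub hM) (Finset.mem_insert_self k A)
  have h' : A ⊆ (insert k A).filter (k < ·) := by
    intro n hn
    have := hAM hn
    simp only [Set.mem_sdiff, Set.mem_Iic] at this
    simp only [Finset.mem_filter, Finset.mem_insert]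
    exact ⟨Or.inr hn, by omega⟩
  have := Finset.card_le_card h'
  omega

theorem generatedIdeal_hom_conv_subset_BIdeal (θ : ℕ ≃ Set.Ioo (0 : ℚ) 1) :
    generatedIdeal (hom (conv θ)) ⊆ BIdeal (evalSeq (homCompacts (conv θ) 0)) := by
  intro M hM
  refine hM _ (isIdealOn_BIdeal _) (Set.iUnion_subset fun i => ?_)
  have hi : i = 0 ∨ i = 1 := by grind
  rcases hi with rfl | rfl
  · exact homColor_conv_zero_subset_BIdeal θ
  · exact homColor_conv_one_subset_BIdeal θ

/-- Along a subsequence of `A` where `θ` converges, thinning until later values are within `1 / (2(k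
+ 1))` of the limit makes the set 1-homogeneous. -/
theorem isTall_BIdeal_conv (θ : ℕ ≃ Set.Ioo (0 : ℚ) 1) :
    IsTall (BIdeal (evalSeq (homCompacts (conv θ) 0))) := by
  intro A hA
  obtain ⟨y, -, φ, hφ, hy⟩ := (isCompact_Icc (a := (0 : ℝ)) (b := 1)).tendsto_subseq
    (x := fun n => ((θ (Nat.nth (· ∈ A) n) : ℚ) : ℝ)) (fun n => by
      have h := (θ (Nat.nth (· ∈ A) n)).2
      exact ⟨by exact_mod_cast h.1.le, by exact_mod_cast h.2.le⟩)
  set e : ℕ → ℕ := fun n => Nat.nth (· ∈ A) (φ n) with he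
  have hemono : StrictMono e := (Nat.nth_strictMono hA).comp hφ
  obtain ⟨s, -, hs⟩ := exists_seq_of_forall_finset_exists (fun _ : ℕ => True)
    (fun i j => i < j ∧ ∀ j' ≥ j, |((θ (e j') : ℚ) : ℝ) - y| < 1 / (2 * ((e i : ℝ) + 1))) (by
      intro s _
      have h : ∀ i ∈ s, ∀ᶠ j in atTop,
          i < j ∧ ∀ j' ≥ j, |((θ (e j') : ℚ) : ℝ) - y| < 1 / (2 * ((e i : ℝ) + 1)) := by
        intro i _
        have h1 : ∀ᶠ j in atTop, |((θ (e j) : ℚ) : ℝ) - y| < 1 / (2 * ((e i : ℝ) + 1)) := by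
          have := Metric.tendsto_nhds.1 hy (1 / (2 * ((e i : ℝ) + 1))) (by positivity)
          simp only [Real.dist_eq] at this
          exact this
        exact (eventually_gt_atTop i).and (eventually_forall_ge_atTop.2 h1)
      obtain ⟨j, hj⟩ := ((Filter.eventually_all_finset s).2 h).exists
      exact ⟨j, trivial, hj⟩)
  have hsmono : StrictMono s := fun i j hij => (hs i j hij).1
  refine ⟨Set.range (e ∘ s), ?_, Set.infinite_range_of_injective
    (hemono.comp hsmono).injective, homColor_conv_one_subset_BIdeal θ ?_⟩
  · rintro _ ⟨n, rfl⟩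
    exact Nat.nth_mem_of_infinite hA _
  · rw [mem_homColor_conv_one]
    rintro _ ⟨k, rfl⟩ _ ⟨l, rfl⟩ _ ⟨m, rfl⟩ hkl hlm
    rw [(hemono.comp hsmono).lt_iff_lt] at hkl hlm
    have h1 := (hs k l hkl).2 _ le_rfl
    have h2 := (hs k m (hkl.trans hlm)).2 _ le_rfl
    have h3 : |((θ (e (s l)) : ℚ) : ℝ) - ((θ (e (s m)) : ℚ) : ℝ)| < 1 / ((e (s k) : ℝ) + 1) := by
      have h4 : 1 / ((e (s k) : ℝ) + 1) =
          1 / (2 * ((e (s k) : ℝ) + 1)) + 1 / (2 * ((e (s k) : ℝ) + 1)) := by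
        field_simp
        norm_num
      rw [h4]
      rw [abs_sub_comm] at h2
      exact (abs_sub_le _ y _).trans_lt (add_lt_add h1 h2)
    refine (Rat.cast_lt (K := ℝ)).1 ?_
    push_cast
    exact h3

/-! ### Representation in `C(𝒮)` -/

theorem isClopen_schreier_coord (i : ℕ) :
    IsClopen {x : schreierCompacts | (x : ℕ → unitInterval) i = 1} := by
  have hc : Continuous fun x : schreierCompacts => (x : ℕ → unitInterval) i :=
    (continuous_apply i).comp continuous_subtype_val
  refine ⟨isClosed_eq hc continuous_const, ?_⟩
  have h : {x : schreierCompacts | (x : ℕ → unitInterval) i = 1} =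
      {x : schreierCompacts | (x : ℕ → unitInterval) i = 0}ᶜ := by
    ext ⟨_, t, ht, rfl⟩
    by_cases hi : i ∈ t <;> simp [charPt, hi]
  rw [h]
  exact (isClosed_eq hc continuous_const).isOpen_compl

open Classical in
/-- The sequence in `C(𝒮)` whose `n`-th term detects whether `n` belongs to the longest initial
segment of a Schreier set which is homogeneous of color `i`. -/
def initialSegmentSeq {d : ℕ} (c : Coloring d) (i : Fin 2) (n : ℕ) : C(schreierCompacts, ℝ) where
  toFun x := if (x : ℕ → unitInterval) n = 1 ∧
    {k | k ≤ n ∧ (x : ℕ → unitInterval) k = 1} ∈ homColor c i then 1 else 0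
  continuous_toFun := by
    -- The value depends only on coordinates up to `n`, so it factors through a finite discrete
    -- space.
    let g : (Fin (n + 1) → Bool) → ℝ := fun v =>
      if v (Fin.last n) = true ∧ {k | ∃ h : k < n + 1, v ⟨k, h⟩ = true} ∈ homColor c i
      then 1 else 0
    let p : schreierCompacts → (Fin (n + 1) → Bool) := fun x k =>
      Set.boolIndicator {x : schreierCompacts | (x : ℕ → unitInterval) k = 1} x
    have hp : Continuous p := continuous_pi fun k =>
      (continuous_boolIndicator_iff_isClopen _).2 (isClopen_schreier_coord k)
    have hg : Continuous g := continuous_of_discreteTopology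
    convert hg.comp hp using 2 with x
    have hpx : ∀ k, p x k = true ↔ (x : ℕ → unitInterval) k = 1 := by
      intro k
      simp [p, ← Set.mem_iff_boolIndicator]
    simp only [g, Function.comp, hpx, Fin.val_last, exists_prop, Nat.lt_succ_iff]

theorem initialSegmentSeq_charPt {d : ℕ} (c : Coloring d) (i : Fin 2) (n : ℕ) {t : Set ℕ}
    (ht : t ∈ schreier) [Decidable (n ∈ t ∧ {k | k ≤ n ∧ k ∈ t} ∈ homColor c i)] :
    initialSegmentSeq c i n ⟨charPt t, t, ht, rfl⟩ =
      if n ∈ t ∧ {k | k ≤ n ∧ k ∈ t} ∈ homColor c i then 1 else 0 := by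
  have h : ∀ k, charPt t k = 1 ↔ k ∈ t := by
    intro k
    by_cases hk : k ∈ t <;> simp [charPt, hk]
  simp only [initialSegmentSeq, ContinuousMap.coe_mk, h]

/-- A sum over `F` counts a homogeneous subset of `F`, giving one bound. Conversely, a homogeneous
set minus its minimum is Schreier and all its initial segments are homogeneous, so it is counted in
full. -/
theorem BIdeal_evalSeq_eq_BIdeal_initialSegmentSeq (θ : ℕ ≃ Set.Ioo (0 : ℚ) 1) :
    BIdeal (evalSeq (homCompacts (conv θ) 0)) = BIdeal (initialSegmentSeq (conv θ) 0) := by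
  classical
  have hval : ∀ (F : Finset ℕ) (t : Set ℕ) (ht : t ∈ schreier),
      (∑ n ∈ F, initialSegmentSeq (conv θ) 0 n) ⟨charPt t, t, ht, rfl⟩ =
        ((F.filter fun n => n ∈ t ∧ {k | k ≤ n ∧ k ∈ t} ∈ homColor (conv θ) 0).card : ℝ) := by
    intro F t ht
    rw [ContinuousMap.sum_apply, Finset.card_filter, Nat.cast_sum]
    refine Finset.sum_congr rfl fun n _ => ?_
    rw [initialSegmentSeq_charPt _ _ _ ht]
    push_cast
    rfl
  have hle : ∀ (F : Finset ℕ) (t : Set ℕ),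
      (∀ n ∈ F, n ∈ t ∧ {k | k ≤ n ∧ k ∈ t} ∈ homColor (conv θ) 0) →
      F.card ≤ (F.filter fun n => n ∈ t ∧ {k | k ≤ n ∧ k ∈ t} ∈ homColor (conv θ) 0).card :=
    fun F t h => (congrArg Finset.card (Finset.filter_true_of_mem h)).ge
  ext M
  rw [mem_BIdeal_evalSeq_homCompacts]
  constructor
  · rintro ⟨C, hC⟩
    refine ⟨C, ?_⟩
    rintro r ⟨F, hF, rfl⟩
    refine (ContinuousMap.norm_le _ (Nat.cast_nonneg C)).2 ?_
    rintro ⟨_, t, ht, rfl⟩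
    rw [hval F t ht, Real.norm_of_nonneg (Nat.cast_nonneg _), Nat.cast_le]
    set B := F.filter fun n => n ∈ t ∧ {k | k ≤ n ∧ k ∈ t} ∈ homColor (conv θ) 0 with hB
    rcases B.eq_empty_or_nonempty with h0 | hne
    · simp [h0]
    refine hC B (fun n hn => hF (Finset.mem_filter.1 hn).1) ?_
    refine homColor_mono _ _ ?_ (Finset.mem_filter.1 (B.max'_mem hne)).2.2
    exact fun n hn => ⟨B.le_max' n hn, (Finset.mem_filter.1 hn).2.1⟩
  · rintro ⟨C, hC⟩
    -- The extra `1` pays for the deleted minimum.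
    refine ⟨⌊C⌋₊ + 1, fun A hAM hA => ?_⟩
    rcases A.eq_empty_or_nonempty with rfl | hne
    · simp
    set k := A.min' hne with hk
    have hcard := card_le_of_mem_homColor_conv_zero θ hA (A.min'_mem hne)
      (fun n hn => A.min'_le n hn)
    have hcard' := Finset.card_erase_add_one (A.min'_mem hne)
    set B := A.erase k with hB
    have hBA : B ⊆ A := Finset.erase_subset _ _
    have hBhom := homColor_mono (conv θ) 0 (Finset.coe_subset.2 hBA) hA
    have hBS : (B : Set ℕ) ∈ schreier := by
      refine ⟨B, rfl, fun n hn => ?_⟩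
      have h1 := A.min'_le n (hBA hn)
      have h2 := Finset.ne_of_mem_erase hn
      omega
    have h := (∑ n ∈ B, initialSegmentSeq (conv θ) 0 n).norm_coe_le_norm
      ⟨charPt B, B, hBS, rfl⟩
    rw [hval B B hBS, Real.norm_of_nonneg (Nat.cast_nonneg _)] at h
    have hfilter := Nat.le_floor (h.trans (hC ⟨B, (Finset.coe_subset.2 hBA).trans hAM, rfl⟩))
    have := (hle B B fun n hn => ⟨hn, homColor_mono _ _ (fun m hm => hm.2) hBhom⟩).trans hfilter
    omega

/-! ### Colorings of pairs against the ideal -/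

theorem coe_pair_mem_powersetCard {a b : ℕ} (hab : a < b) :
    ({a, b} : Finset ℕ) ∈ Set.powersetCard ℕ 2 :=
  Set.powersetCard.mem_iff.2 (Finset.card_pair hab.ne)

theorem exists_pair_eq (s : Set.powersetCard ℕ 2) :
    ∃ a b : ℕ, a < b ∧ (s : Finset ℕ) = {a, b} := by
  obtain ⟨a, b, hab, h⟩ := Finset.card_eq_two.1 (Set.powersetCard.mem_iff.1 s.2)
  rcases hab.lt_or_gt with h' | h'
  · exact ⟨a, b, h', h⟩
  · exact ⟨b, a, h', h.trans (Finset.pair_comm a b)⟩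

theorem mem_homColor_two (c : Coloring 2) (i : Fin 2) (A : Set ℕ) :
    A ∈ homColor c i ↔ ∀ a ∈ A, ∀ b ∈ A, ∀ hab : a < b,
      c ⟨{a, b}, coe_pair_mem_powersetCard hab⟩ = i := by
  constructor
  · intro h a ha b hb hab
    exact h _ (by simp [Set.insert_subset_iff, ha, hb])
  · rintro h ⟨s, hs⟩ hsA
    obtain ⟨a, b, hab, rfl⟩ := exists_pair_eq ⟨s, hs⟩
    exact h a (hsA (by simp)) b (hsA (by simp)) hab

/-- No `2`-coloring of pairs has all its homogeneous sets in the ideal of `hom₀(conv)`. -/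
theorem not_hom_subset_BIdeal_conv (θ : ℕ ≃ Set.Ioo (0 : ℚ) 1) (c : Coloring 2) :
    ¬ hom c ⊆ BIdeal (evalSeq (homCompacts (conv θ) 0)) := by
  intro hsub
  obtain ⟨ε, M, hM, hA⟩ := exists_homogeneous_separated θ
    (fun a b => if hab : a < b then c ⟨{a, b}, coe_pair_mem_powersetCard hab⟩ else 0)
  have hMhom : M ∈ hom c := Set.mem_iUnion.2 ⟨ε, (mem_homColor_two c ε M).2 fun a ha b hb hab => by
    have := hM a ha b hb hab
    rwa [dif_pos hab] at this⟩
  obtain ⟨C, hC⟩ := (mem_BIdeal_evalSeq_homCompacts _ _ M).1 (hsub hMhom)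
  obtain ⟨A, hAM, hcard, hsep⟩ := hA (C + 1)
  have := hC A hAM ((mem_homColor_conv_zero θ _).2 fun k hk l hl m hm _ hlm => by
    have h := hsep k hk l hl m hm hlm
    refine (Rat.cast_le (K := ℝ)).1 ?_
    push_cast
    exact h)
  omega

/-! ### Tall ideals represented in `c₀` -/

section ZeroAtInfty

open ZeroAtInfty

theorem abs_apply_le_norm (f : C₀(ℕ, ℝ)) (j : ℕ) : |f j| ≤ ‖f‖ :=
  f.toBCF.norm_coe_le_norm j

theorem norm_le_of_forall_abs_le {f : C₀(ℕ, ℝ)} {C : ℝ} (hC : 0 ≤ C) (h : ∀ j, |f j| ≤ C) :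
    ‖f‖ ≤ C :=
  (BoundedContinuousFunction.norm_le (f := f.toBCF) hC).2 h

theorem zeroAtInfty_sum_apply (x : ℕ → C₀(ℕ, ℝ)) (F : Finset ℕ) (j : ℕ) :
    (∑ n ∈ F, x n) j = ∑ n ∈ F, x n j := by
  classical
  induction F using Finset.induction_on with
  | empty => simp
  | insert a s ha ih => simp [Finset.sum_insert ha, ih]

theorem exists_norm_le_of_isTall {X : Type*} [NormedAddCommGroup X] {x : ℕ → X}
    (hx : IsTall (BIdeal x)) : ∃ C, ∀ n, ‖x n‖ ≤ C := by
  by_contra! hcon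
  have hfreq : ∀ k : ℕ, ∃ᶠ n in atTop, (k : ℝ) < ‖x n‖ := by
    intro k hk
    have hbdd : IsBoundedUnder (· ≤ ·) atTop fun n => ‖x n‖ :=
      ⟨k, eventually_map.2 (hk.mono fun n hn => not_lt.1 hn)⟩
    obtain ⟨C, hC⟩ := hbdd.bddAbove_range
    obtain ⟨n, hn⟩ := hcon C
    exact hn.not_ge (hC ⟨n, rfl⟩)
  obtain ⟨φ, hφ, hφx⟩ := extraction_forall_of_frequently hfreq
  obtain ⟨B, hBA, hB, C, hC⟩ := hx _ (Set.infinite_range_of_injective hφ.injective)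
  have hsub : B ⊆ φ '' {k | (k : ℝ) ≤ C} := by
    intro n hn
    obtain ⟨k, rfl⟩ := hBA hn
    refine ⟨k, ?_, rfl⟩
    exact (hφx k).le.trans (hC ⟨{φ k}, by simpa using hn, by simp⟩)
  refine hB (Set.Finite.subset (Set.Finite.image _ ?_) hsub)
  exact (Set.finite_Iic ⌊C⌋₊).subset fun k hk => Nat.le_floor hk

/-- Otherwise tallness gives an infinite member of the ideal inside the set, where terms of one sign
exceeding `δ` add up without bound at coordinate `j`. -/
theorem finite_setOf_lt_mul_of_isTall {x : ℕ → C₀(ℕ, ℝ)} (hx : IsTall (BIdeal x)) (j : ℕ)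
    {δ : ℝ} (hδ : 0 < δ) {σ : ℝ} (hσ : |σ| = 1) : {m | δ < σ * x m j}.Finite := by
  by_contra hinf
  obtain ⟨B, hBA, hB, C, hC⟩ := hx _ hinf
  obtain ⟨F, hF, hcard⟩ := hB.exists_subset_card_eq (⌈C / δ⌉₊ + 1)
  have h1 := (abs_apply_le_norm _ j).trans (hC ⟨F, hF, rfl⟩)
  rw [zeroAtInfty_sum_apply, ← one_mul |_|, ← hσ, ← abs_mul, Finset.mul_sum] at h1
  have h2 : F.card • δ ≤ ∑ n ∈ F, σ * x n j :=
    Finset.card_nsmul_le_sum _ _ _ fun n hn => (hBA (hF hn)).le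
  have h3 := (h2.trans (le_abs_self _)).trans h1
  rw [nsmul_eq_mul, ← le_div_iff₀ hδ, hcard] at h3
  push_cast at h3
  linarith [Nat.le_ceil (C / δ)]

theorem finite_setOf_lt_abs_of_isTall {x : ℕ → C₀(ℕ, ℝ)} (hx : IsTall (BIdeal x)) (j : ℕ)
    {δ : ℝ} (hδ : 0 < δ) : {m | δ < |x m j|}.Finite := by
  refine ((finite_setOf_lt_mul_of_isTall hx j hδ (σ := 1) (by simp)).union
    (finite_setOf_lt_mul_of_isTall hx j hδ (σ := -1) (by simp))).subset fun m hm => ?_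
  simpa [lt_abs] using hm

/-- `D` pays for the least element `a`; then `(1 / 2) ^ a` replaces `D` for the rest, hence the
quantifier over `D` inside the induction. -/
theorem sum_abs_le_of_abs_le_pow {y : ℕ → ℝ} (G : Finset ℕ)
    (h : ∀ a ∈ G, ∀ b ∈ G, a < b → |y b| ≤ (1 / 2) ^ a) :
    ∀ D : ℝ, 0 ≤ D → (∀ b ∈ G, |y b| ≤ D) → ∑ b ∈ G, |y b| ≤ D + ∑ b ∈ G, (1 / 2 : ℝ) ^ b := by
  classical
  induction G using Finset.induction_on_min with
  | empty => simp
  | insert a s ha ih =>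
    intro D _ hy
    have has : a ∉ s := fun h => (ha a h).false
    rw [Finset.sum_insert has, Finset.sum_insert has]
    refine add_le_add (hy a (Finset.mem_insert_self a s)) (ih (fun b hb c hc => ?_) _
      (by positivity) fun b hb => ?_)
    · exact h b (Finset.mem_insert_of_mem hb) c (Finset.mem_insert_of_mem hc)
    · exact h a (Finset.mem_insert_self a s) b (Finset.mem_insert_of_mem hb) (ha b hb)

theorem sum_half_pow_le_two (F : Finset ℕ) : ∑ n ∈ F, (1 / 2 : ℝ) ^ n ≤ 2 :=
  (summable_geometric_two.sum_le_tsum F fun _ _ => by positivity).trans_eq tsum_geometric_two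

/-- A tall ideal represented in `c₀` contains all homogeneous sets of some coloring of pairs. -/
theorem exists_hom_subset_BIdeal_of_isTall {x : ℕ → C₀(ℕ, ℝ)} (hx : IsTall (BIdeal x)) :
    ∃ c : Coloring 2, hom c ⊆ BIdeal x := by
  classical
  obtain ⟨C, hC⟩ := exists_norm_le_of_isTall hx
  have hC0 : 0 ≤ C := (norm_nonneg _).trans (hC 0)
  have hJ : ∀ n, ∃ J : ℕ, ∀ j > J, |x n j| ≤ (1 / 2) ^ n := by
    intro n
    have h : Tendsto (x n) atTop (𝓝 0) := by
      have := (x n).zero_at_infty'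
      rwa [cocompact_eq_cofinite, Nat.cofinite_eq_atTop] at this
    obtain ⟨J, hJ⟩ := eventually_atTop.1
      (Metric.tendsto_nhds.1 h ((1 / 2) ^ n) (by positivity))
    refine ⟨J, fun j hj => ?_⟩
    have := hJ j (le_of_lt hj)
    rw [Real.dist_eq, sub_zero] at this
    exact this.le
  choose J hJ using hJ
  -- `R n m` says that `x m` is small on the coordinates up to `J n`, beyond which `x n` is small.
  let R : ℕ → ℕ → Prop := fun n m => ∀ j ≤ J n, |x m j| ≤ (1 / 2) ^ n
  let c : Coloring 2 := fun s =>
    if ∀ a b, a < b → (s : Finset ℕ) = {a, b} → R a b then 1 else 0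
  have hc1 : ∀ a b (hab : a < b), c ⟨{a, b}, coe_pair_mem_powersetCard hab⟩ = 1 → R a b := by
    intro a b hab h
    by_contra hR
    simp only [c] at h
    rw [if_neg fun h' => hR (h' a b hab rfl)] at h
    exact absurd h (by decide)
  have hc0 : ∀ a b (hab : a < b), c ⟨{a, b}, coe_pair_mem_powersetCard hab⟩ = 0 → ¬ R a b := by
    intro a b hab h hR
    simp only [c] at h
    rw [if_pos] at h
    · exact absurd h (by decide)
    intro a' b' hab' h'
    have h1 := Finset.ext_iff.1 h'
    have := (h1 a).1 (by simp)
    have := (h1 b).1 (by simp)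
    simp only [Finset.mem_insert, Finset.mem_singleton] at *
    obtain ⟨rfl, rfl⟩ : a = a' ∧ b = b' := by omega
    exact hR
  refine ⟨c, Set.iUnion_subset fun i M hM => ?_⟩
  rw [mem_homColor_two] at hM
  have hi : i = 0 ∨ i = 1 := by grind
  rcases hi with rfl | rfl
  -- Color `0`: coordinates tend to `0`, so for fixed `n` only finitely many `m` fail `R n m`, and
  -- `M` is finite.
  · refine (isIdealOn_BIdeal x).finite_mem M ?_
    rcases M.eq_empty_or_nonempty with rfl | ⟨n, hn⟩
    · exact Set.finite_empty
    have hfin : (⋃ j ∈ Finset.range (J n + 1), {m | ((1 / 2 : ℝ)) ^ n < |x m j|}).Finite :=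
      (Finset.range (J n + 1)).finite_toSet.biUnion fun j _ =>
        finite_setOf_lt_abs_of_isTall hx j (by positivity)
    refine ((Set.finite_Iic n).union hfin).subset fun m hm => ?_
    rcases le_or_gt m n with h | h
    · exact Or.inl h
    · right
      have h1 := hc0 n m h (hM n hn m hm h)
      simp only [R, not_forall, not_le] at h1
      obtain ⟨j, hj, hlt⟩ := h1
      simp only [Set.mem_iUnion, Finset.mem_range]
      exact ⟨j, by omega, hlt⟩
  -- Color `1`: at coordinate `j`, terms past their `J n` sum to at most `2`; among the others the
  -- first costs `C` and the rest at most `2`.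
  · refine ⟨2 + (C + 2), ?_⟩
    rintro r ⟨F, hF, rfl⟩
    refine norm_le_of_forall_abs_le (by positivity) fun j => ?_
    rw [zeroAtInfty_sum_apply]
    refine (Finset.abs_sum_le_sum_abs _ _).trans ?_
    rw [← Finset.sum_filter_add_sum_filter_not F (fun n => J n < j)]
    refine add_le_add ?_ ?_
    · refine (Finset.sum_le_sum fun n hn => ?_).trans
        (sum_half_pow_le_two (F.filter fun n => J n < j))
      exact hJ n j (Finset.mem_filter.1 hn).2
    · refine (sum_abs_le_of_abs_le_pow (y := fun n => x n j) _ (fun a ha b hb hab => ?_) C hC0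
        fun b _ => (abs_apply_le_norm _ j).trans (hC b)).trans
        (add_le_add le_rfl (sum_half_pow_le_two _))
      obtain ⟨haF, ha'⟩ := Finset.mem_filter.1 ha
      exact hc1 a b hab (hM a (hF haF) b (hF (Finset.mem_filter.1 hb).1) hab) j (not_lt.1 ha')

end ZeroAtInfty

end ConvColoring

end

theorem mainTheorem2 (θ : ℕ ≃ Set.Ioo (0 : ℚ) 1) :
    (∀ c : ConvColoring.Coloring 2,
      ¬ ConvColoring.hom c ⊆ ConvColoring.generatedIdeal (ConvColoring.hom (ConvColoring.conv θ))) ∧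
    (∀ c : ConvColoring.Coloring 2,
      ¬ ConvColoring.hom c ⊆
        ConvColoring.BIdeal
          (ConvColoring.evalSeq (ConvColoring.homCompacts (ConvColoring.conv θ) 0))) ∧
    ConvColoring.IsIdealOn
      (ConvColoring.BIdeal
        (ConvColoring.evalSeq (ConvColoring.homCompacts (ConvColoring.conv θ) 0))) ∧
    ConvColoring.IsTall
      (ConvColoring.BIdeal
        (ConvColoring.evalSeq (ConvColoring.homCompacts (ConvColoring.conv θ) 0))) ∧
    ConvColoring.BRepresentable C(ConvColoring.schreierCompacts, ℝ)
      (ConvColoring.BIdeal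
        (ConvColoring.evalSeq (ConvColoring.homCompacts (ConvColoring.conv θ) 0))) ∧
    ¬ ConvColoring.BRepresentable (ZeroAtInftyContinuousMap ℕ ℝ)
      (ConvColoring.BIdeal
        (ConvColoring.evalSeq (ConvColoring.homCompacts (ConvColoring.conv θ) 0))) := by
  refine ⟨fun c hc => ConvColoring.not_hom_subset_BIdeal_conv θ c
      (hc.trans (ConvColoring.generatedIdeal_hom_conv_subset_BIdeal θ)),
    ConvColoring.not_hom_subset_BIdeal_conv θ, ConvColoring.isIdealOn_BIdeal _,
    ConvColoring.isTall_BIdeal_conv θ,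
    ⟨_, ConvColoring.BIdeal_evalSeq_eq_BIdeal_initialSegmentSeq θ⟩, ?_⟩
  rintro ⟨x, hx⟩
  obtain ⟨c, hc⟩ := ConvColoring.exists_hom_subset_BIdeal_of_isTall
    (hx ▸ ConvColoring.isTall_BIdeal_conv θ)
  exact ConvColoring.not_hom_subset_BIdeal_conv θ c (hx ▸ hc)
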